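/- Let $p$ be a prime with $p\equiv 1\pmod 3$. Then $$\sum_{k=1}^{\lfloor 2p/3\rfloor}\binom{2k}{k}(-2)^k\equiv 0\pmod{p^2}$$ and $$\sum_{k=0}^{\lfloor 5p/6\rfloor}\frac{\binom{2k}{k}}{(-32)^k}\equiv\left(\frac{2}{p}\right)\pmod{p^2},$$ where $\left(\frac{\cdot}{p}\right)$ is the Legendre symbol, and a congruence $x\equiv y\pmod{p^2}$ between rational numbers means that $x-y=p^2z$ for some rational number $z$ whose reduced denominator is not divisible by $p$. -/

import Mathlib

/-- Congruence of rational numbers modulo `m`: the difference `x - y` is `m` times a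
rational number whose reduced denominator is coprime to `m`. When `m` is a power of a prime `p`
this is the usual congruence in the ring of `p`-integral rationals. -/
def RatModEq (m : ℕ) (x y : ℚ) : Prop :=
  ∃ z : ℚ, z.den.Coprime m ∧ x - y = (m : ℚ) * z

/-- The ring of rational numbers whose reduced denominator is prime to `p`. -/
def pIntegral (p : ℕ) [Fact p.Prime] : Subring ℚ where
  carrier := {q | q.den.Coprime p}
  mul_mem' {a b} ha hb :=
    Nat.Coprime.of_dvd_left (Rat.mul_den_dvd a b) (Nat.Coprime.mul_left ha hb)
  one_mem' := by simp
  add_mem' {a b} ha hb :=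
    Nat.Coprime.of_dvd_left (Rat.add_den_dvd a b) (Nat.Coprime.mul_left ha hb)
  zero_mem' := by simp
  neg_mem' {a} ha := by simpa using ha

section

variable {p : ℕ} [hpp : Fact p.Prime]

theorem mem_pIntegral {q : ℚ} : q ∈ pIntegral p ↔ q.den.Coprime p := Iff.rfl

theorem inv_natCast_mem_pIntegral {m : ℕ} (hm : ¬ p ∣ m) : (m : ℚ)⁻¹ ∈ pIntegral p := by
  have h0 : 0 < m := Nat.pos_of_ne_zero (by rintro rfl; simp at hm)
  rw [mem_pIntegral, Rat.inv_natCast_den_of_pos h0]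
  exact ((Nat.Prime.coprime_iff_not_dvd hpp.out).2 hm).symm

theorem inv_intCast_mem_pIntegral {m : ℤ} (hm : ¬ (p : ℤ) ∣ m) : (m : ℚ)⁻¹ ∈ pIntegral p := by
  obtain ⟨n, rfl | rfl⟩ := m.eq_nat_or_neg
  · rw [Int.cast_natCast]
    exact inv_natCast_mem_pIntegral (by exact_mod_cast hm)
  · have : ¬ p ∣ n := by
      intro h; exact hm (by rw [dvd_neg]; exact_mod_cast h)
    rw [Int.cast_neg, Int.cast_natCast, ← neg_inv]
    exact neg_mem (inv_natCast_mem_pIntegral this)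

theorem inv_one_add_mem_pIntegral {x : ℚ} (hx : x ∈ pIntegral p) :
    1 + p * x ≠ 0 ∧ (1 + p * x)⁻¹ ∈ pIntegral p := by
  have hd : (x.den : ℚ) ≠ 0 := by exact_mod_cast x.den_ne_zero
  have hnd : ¬ (p : ℤ) ∣ x.den + p * x.num := by
    intro h
    have h1 : (p : ℤ) ∣ x.den := (Int.dvd_add_left (Dvd.intro _ rfl)).1 h
    have h2 : p ∣ x.den := by exact_mod_cast h1
    exact (Nat.Prime.coprime_iff_not_dvd hpp.out).1 (mem_pIntegral.1 hx).symm h2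
  have e : 1 + p * x = ((x.den + p * x.num : ℤ) : ℚ) * (x.den : ℚ)⁻¹ := by
    push_cast
    rw [← Rat.mul_den_eq_num x]
    field_simp
  have hne : ((x.den + p * x.num : ℤ) : ℚ) ≠ 0 := by
    rw [Int.cast_ne_zero]
    rintro h
    exact hnd (h ▸ dvd_zero _)
  rw [e]
  refine ⟨mul_ne_zero hne (inv_ne_zero hd), ?_⟩
  rw [mul_inv, inv_inv]
  exact mul_mem (inv_intCast_mem_pIntegral hnd) (natCast_mem _ _)

variable (p) in
/-- `u` is congruent to `1 + p * l` modulo `p ^ 2`, with `l` a `p`-integral number. -/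
def HasLog (u l : ℚ) : Prop :=
  l ∈ pIntegral p ∧ ∃ z ∈ pIntegral p, u = 1 + p * l + p ^ 2 * z

variable (p) in
/-- Congruence modulo `p` in the ring of `p`-integral numbers. -/
def CongrModPrime (x y : ℚ) : Prop := ∃ z ∈ pIntegral p, x - y = p * z

namespace HasLog

variable {u v l m : ℚ}

theorem one : HasLog p 1 0 := ⟨zero_mem _, 0, zero_mem _, by ring⟩

theorem one_add (hl : l ∈ pIntegral p) : HasLog p (1 + p * l) l :=
  ⟨hl, 0, zero_mem _, by ring⟩

theorem mul (hu : HasLog p u l) (hv : HasLog p v m) : HasLog p (u * v) (l + m) := by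
  obtain ⟨hl, z, hz, rfl⟩ := hu
  obtain ⟨hm, w, hw, rfl⟩ := hv
  have hp : (p : ℚ) ∈ pIntegral p := natCast_mem _ _
  refine ⟨add_mem hl hm, z + w + (l + p * z) * (m + p * w), ?_, by ring⟩
  exact add_mem (add_mem hz hw)
    (mul_mem (add_mem hl (mul_mem hp hz)) (add_mem hm (mul_mem hp hw)))

theorem ne_zero_and_inv_mem (hu : HasLog p u l) : u ≠ 0 ∧ u⁻¹ ∈ pIntegral p := by
  obtain ⟨hl, z, hz, rfl⟩ := hu
  have := inv_one_add_mem_pIntegral (p := p) (x := l + p * z)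
    (add_mem hl (mul_mem (natCast_mem _ _) hz))
  rwa [show 1 + (p : ℚ) * (l + p * z) = 1 + p * l + p ^ 2 * z by ring] at this

theorem ne_zero (hu : HasLog p u l) : u ≠ 0 := hu.ne_zero_and_inv_mem.1

theorem inv (hu : HasLog p u l) : HasLog p u⁻¹ (-l) := by
  obtain ⟨h0, hi⟩ := hu.ne_zero_and_inv_mem
  obtain ⟨hl, z, hz, hu⟩ := hu
  refine ⟨neg_mem hl, (l ^ 2 - z + p * (l * z)) * u⁻¹, ?_, ?_⟩
  · exact mul_mem (add_mem (sub_mem (pow_mem hl 2) hz)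
      (mul_mem (natCast_mem _ _) (mul_mem hl hz))) hi
  · field_simp
    rw [hu]
    ring

theorem div (hu : HasLog p u l) (hv : HasLog p v m) : HasLog p (u / v) (l - m) := by
  simpa [div_eq_mul_inv, sub_eq_add_neg] using hu.mul hv.inv

theorem pow (hu : HasLog p u l) (n : ℕ) : HasLog p (u ^ n) (n * l) := by
  induction n with
  | zero => simpa using one
  | succ n ih => simpa [pow_succ, add_mul] using ih.mul hu

theorem prod {ι : Type*} {s : Finset ι} {f g : ι → ℚ} (h : ∀ i ∈ s, HasLog p (f i) (g i)) :
    HasLog p (∏ i ∈ s, f i) (∑ i ∈ s, g i) := by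
  classical
  induction s using Finset.induction_on with
  | empty => simpa using one
  | insert a s ha ih =>
    rw [Finset.prod_insert ha, Finset.sum_insert ha]
    exact (h a (by simp)).mul (ih fun i hi => h i (by simp [hi]))

theorem congr_log (hu : HasLog p u l) (hv : HasLog p u m) : CongrModPrime p l m := by
  obtain ⟨hl, z, hz, hu⟩ := hu
  obtain ⟨hm, w, hw, hv⟩ := hv
  have hp : (p : ℚ) ≠ 0 := by exact_mod_cast hpp.out.ne_zero
  refine ⟨w - z, sub_mem hw hz, mul_left_cancel₀ hp ?_⟩
  linear_combination hv - hu

end HasLog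

variable (p) in
/-- As a function of `t`, `F t` is affine in `p * t` modulo `p ^ 2`. -/
def AffineModSq (F : ℚ → ℚ) : Prop :=
  ∃ c ∈ pIntegral p, ∃ d ∈ pIntegral p, ∀ t ∈ pIntegral p, ∃ z ∈ pIntegral p,
    F t = c + d * (p * t) + p ^ 2 * z

namespace AffineModSq

variable {F G : ℚ → ℚ}

theorem linear {c d : ℚ} (hc : c ∈ pIntegral p) (hd : d ∈ pIntegral p) :
    AffineModSq p fun t => c + d * (p * t) :=
  ⟨c, hc, d, hd, fun _ _ => ⟨0, zero_mem _, by ring⟩⟩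

theorem const {c : ℚ} (hc : c ∈ pIntegral p) : AffineModSq p fun _ => c :=
  ⟨c, hc, 0, zero_mem _, fun _ _ => ⟨0, zero_mem _, by ring⟩⟩

theorem add (hF : AffineModSq p F) (hG : AffineModSq p G) : AffineModSq p fun t => F t + G t := by
  obtain ⟨c, hc, d, hd, hF⟩ := hF
  obtain ⟨c', hc', d', hd', hG⟩ := hG
  refine ⟨c + c', add_mem hc hc', d + d', add_mem hd hd', fun t ht => ?_⟩
  obtain ⟨z, hz, h⟩ := hF t ht
  obtain ⟨z', hz', h'⟩ := hG t ht
  exact ⟨z + z', add_mem hz hz', by simp only [h, h']; ring⟩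

theorem mul (hF : AffineModSq p F) (hG : AffineModSq p G) : AffineModSq p fun t => F t * G t := by
  obtain ⟨c, hc, d, hd, hF⟩ := hF
  obtain ⟨c', hc', d', hd', hG⟩ := hG
  refine ⟨c * c', mul_mem hc hc', c * d' + d * c', add_mem (mul_mem hc hd') (mul_mem hd hc'),
    fun t ht => ?_⟩
  obtain ⟨z, hz, h⟩ := hF t ht
  obtain ⟨z', hz', h'⟩ := hG t ht
  have hp : (p : ℚ) ∈ pIntegral p := natCast_mem _ _
  refine ⟨(c + d * (p * t)) * z' + z * (c' + d' * (p * t) + p ^ 2 * z') + d * t * (d' * t),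
    ?_, by simp only [h, h']; ring⟩
  have hpt := mul_mem hp ht
  exact add_mem (add_mem (mul_mem (add_mem hc (mul_mem hd hpt)) hz')
    (mul_mem hz (add_mem (add_mem hc' (mul_mem hd' hpt)) (mul_mem (pow_mem hp 2) hz'))))
    (mul_mem (mul_mem hd ht) (mul_mem hd' ht))

theorem inv_sub {u : ℚ} (h0 : u ≠ 0) (hu : u⁻¹ ∈ pIntegral p) :
    AffineModSq p fun t => (u - p * t)⁻¹ := by
  refine ⟨u⁻¹, hu, u⁻¹ * u⁻¹, mul_mem hu hu, fun t ht => ?_⟩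
  have h := (HasLog.one_add (p := p) (neg_mem (mul_mem ht hu))).inv
  obtain ⟨-, z, hz, h⟩ := h
  refine ⟨u⁻¹ * z, mul_mem hu hz, ?_⟩
  have e : u - p * t = u * (1 + p * -(t * u⁻¹)) := by field_simp; ring
  change (u - p * t)⁻¹ = _
  rw [e, mul_inv, h]
  ring

theorem prod {ι : Type*} {s : Finset ι} {f : ι → ℚ → ℚ} (h : ∀ i ∈ s, AffineModSq p (f i)) :
    AffineModSq p fun t => ∏ i ∈ s, f i t := by
  classical
  induction s using Finset.induction_on with
  | empty => simpa using const (one_mem _)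
  | insert a s ha ih =>
    simp only [Finset.prod_insert ha]
    exact (h a (by simp)).mul (ih fun i hi => h i (by simp [hi]))

theorem sum {ι : Type*} {s : Finset ι} {f : ι → ℚ → ℚ} (h : ∀ i ∈ s, AffineModSq p (f i)) :
    AffineModSq p fun t => ∑ i ∈ s, f i t := by
  classical
  induction s using Finset.induction_on with
  | empty => simpa using const (zero_mem _)
  | insert a s ha ih =>
    simp only [Finset.sum_insert ha]
    exact (h a (by simp)).add (ih fun i hi => h i (by simp [hi]))

/-- The value at `0` is determined modulo `p ^ 2` by the values at two other points. -/
theorem interpolate (hF : AffineModSq p F) {s t a b : ℚ} (hs : s ∈ pIntegral p)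
    (ht : t ∈ pIntegral p) (ha : a ∈ pIntegral p) (hb : b ∈ pIntegral p)
    (hab : a + b = 1) (hst : a * s + b * t = 0) :
    ∃ z ∈ pIntegral p, F 0 - (a * F s + b * F t) = p ^ 2 * z := by
  obtain ⟨c, hc, d, hd, hF⟩ := hF
  obtain ⟨x, hx, h0⟩ := hF 0 (zero_mem _)
  obtain ⟨y, hy, h1⟩ := hF s hs
  obtain ⟨z, hz, h2⟩ := hF t ht
  refine ⟨x - (a * y + b * z), sub_mem hx (add_mem (mul_mem ha hy) (mul_mem hb hz)), ?_⟩
  rw [h0, h1, h2]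
  linear_combination (-c) * hab - d * p * hst

end AffineModSq

end

/-- The terms of the hypergeometric series `₂F₁(a, 2a - 1/3; 2/3; -8)`. -/
def termNegEight (a : ℚ) (k : ℕ) : ℚ :=
  ∏ j ∈ Finset.range k, ((a + j) * (2 * a - 1 / 3 + j) * (2 / 3 + j : ℚ)⁻¹ * (1 + j : ℚ)⁻¹ * -8)

/-- The terms of the hypergeometric series `₂F₁(a, a + 1/3; 4/3 - a; -1/8)`. -/
def termNegEighth (a : ℚ) (k : ℕ) : ℚ :=
  ∏ j ∈ Finset.range k,
    ((a + j) * (a + 1 / 3 + j) * (4 / 3 - a + j)⁻¹ * (1 + j : ℚ)⁻¹ * (-1 / 8))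

theorem termNegEight_succ (a : ℚ) (k : ℕ) :
    termNegEight a (k + 1) * ((2 / 3 + k) * (1 + k)) =
      termNegEight a k * ((a + k) * (2 * a - 1 / 3 + k) * -8) := by
  have h1 : (2 / 3 + k : ℚ) ≠ 0 := by positivity
  have h2 : (1 + k : ℚ) ≠ 0 := by positivity
  rw [termNegEight, Finset.prod_range_succ, ← termNegEight]
  field_simp

theorem termNegEighth_succ {a : ℚ} {k : ℕ} (h : 4 / 3 - a + k ≠ 0) :
    termNegEighth a (k + 1) * ((4 / 3 - a + k) * (1 + k)) =
      termNegEighth a k * ((a + k) * (a + 1 / 3 + k) * (-1 / 8)) := by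
  have h2 : (1 + k : ℚ) ≠ 0 := by positivity
  rw [termNegEighth, Finset.prod_range_succ, ← termNegEighth]
  generalize 4 / 3 - a + (k : ℚ) = x at h ⊢
  field_simp

theorem termNegEight_eq_zero {a : ℚ} {j k : ℕ} (hjk : j < k)
    (h : a + j = 0 ∨ 2 * a - 1 / 3 + j = 0) : termNegEight a k = 0 :=
  Finset.prod_eq_zero (Finset.mem_range.2 hjk) (by rcases h with h | h <;> rw [h] <;> simp)

theorem termNegEighth_eq_zero {a : ℚ} {j k : ℕ} (hjk : j < k)
    (h : a + j = 0 ∨ a + 1 / 3 + j = 0) : termNegEighth a k = 0 :=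
  Finset.prod_eq_zero (Finset.mem_range.2 hjk) (by rcases h with h | h <;> rw [h] <;> simp)

theorem termNegEight_add_one (a : ℚ) (k : ℕ) :
    termNegEight (a + 1) k * (a * (2 * a - 1 / 3) * (2 * a + 2 / 3)) =
      termNegEight a k * ((a + k) * (2 * a - 1 / 3 + k) * (2 * a + 2 / 3 + k)) := by
  induction k with
  | zero => simp [termNegEight]
  | succ k ih =>
    have h1 : (2 / 3 + k : ℚ) * (1 + k) ≠ 0 := by positivity
    refine mul_right_cancel₀ h1 ?_
    have e1 := termNegEight_succ (a + 1) k
    have e2 := termNegEight_succ a k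
    push_cast
    linear_combination (a * (2 * a - 1 / 3) * (2 * a + 2 / 3)) * e1
      + ((a + 1 + k) * (2 * (a + 1) - 1 / 3 + k) * -8) * ih
      - ((a + (k + 1)) * (2 * a - 1 / 3 + (k + 1)) * (2 * a + 2 / 3 + (k + 1))) * e2

theorem termNegEighth_add_one {a : ℚ} (h : ∀ k : ℕ, 1 / 3 - a + k ≠ 0) (k : ℕ) :
    termNegEighth (a + 1) k * (a * (a + 1 / 3) * (1 / 3 - a)) =
      termNegEighth a k * ((a + k) * (a + 1 / 3 + k) * (1 / 3 - a + k)) := by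
  induction k with
  | zero => simp [termNegEighth]
  | succ k ih =>
    have h1 : 4 / 3 - (a + 1) + k ≠ 0 := by convert h k using 1; ring
    have h2 : 4 / 3 - a + k ≠ 0 := by convert h (k + 1) using 1; push_cast; ring
    have h3 : (1 + k : ℚ) ≠ 0 := by positivity
    have e1 := termNegEighth_succ h1
    have e2 := termNegEighth_succ h2
    refine mul_right_cancel₀ (mul_ne_zero (mul_ne_zero h1 h3) h2) ?_
    push_cast
    linear_combination (a * (a + 1 / 3) * (1 / 3 - a)) * (4 / 3 - a + k) * e1
      + ((a + 1 + k) * (a + 1 + 1 / 3 + k) * (-1 / 8)) * (4 / 3 - a + k) * ih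
      - ((a + (k + 1)) * (a + 1 / 3 + (k + 1)) * (1 / 3 - a + (k + 1))) *
        (4 / 3 - (a + 1) + k) * e2

theorem sum_termNegEight_telescope (a : ℚ) (K : ℕ) :
    (∑ k ∈ Finset.range K, termNegEight a k + 27 * ∑ k ∈ Finset.range K, termNegEight (a + 1) k) *
        (a * (2 * a - 1 / 3) * (2 * a + 2 / 3)) =
      termNegEight a K * (K * (K - 1 / 3) * (-3 * K + (2 / 3 - 7 * a))) := by
  induction K with
  | zero => simp
  | succ K ih =>
    rw [Finset.sum_range_succ, Finset.sum_range_succ]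
    have e1 := termNegEight_add_one a K
    have e2 := termNegEight_succ a K
    push_cast
    linear_combination ih + 27 * e1 - (-3 * (K + 1) + (2 / 3 - 7 * a)) * e2

theorem sum_termNegEighth_telescope {a : ℚ} (h : ∀ k : ℕ, 1 / 3 - a + k ≠ 0) (K : ℕ) :
    (16 * (1 / 3 - 2 * a) * ∑ k ∈ Finset.range K, termNegEighth a k
        - 27 * (1 / 3 - a) * ∑ k ∈ Finset.range K, termNegEighth (a + 1) k) *
        (a * (a + 1 / 3)) =
      termNegEighth a K * (K * (K + 1 / 3 - a) * (24 * K + (16 / 3 + 40 * a))) := by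
  induction K with
  | zero => simp
  | succ K ih =>
    rw [Finset.sum_range_succ, Finset.sum_range_succ]
    have h2 : 4 / 3 - a + K ≠ 0 := by convert h (K + 1) using 1; push_cast; ring
    have e1 := termNegEighth_add_one h K
    have e2 := termNegEighth_succ h2
    push_cast
    linear_combination ih - 27 * e1 - (24 * (K + 1) + (16 / 3 + 40 * a)) * e2

theorem sum_termNegEight_zero {K : ℕ} (hK : 0 < K) {a : ℚ} (h : a = 0 ∨ 2 * a - 1 / 3 = 0) :
    ∑ k ∈ Finset.range K, termNegEight a k = 1 := by
  rw [Finset.sum_eq_single_of_mem 0 (Finset.mem_range.2 hK)]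
  · simp [termNegEight]
  · intro k _ hk
    exact termNegEight_eq_zero (Nat.pos_of_ne_zero hk) (by simpa using h)

theorem sum_termNegEighth_zero {K : ℕ} (hK : 0 < K) {a : ℚ} (h : a = 0 ∨ a + 1 / 3 = 0) :
    ∑ k ∈ Finset.range K, termNegEighth a k = 1 := by
  rw [Finset.sum_eq_single_of_mem 0 (Finset.mem_range.2 hK)]
  · simp [termNegEighth]
  · intro k _ hk
    exact termNegEighth_eq_zero (Nat.pos_of_ne_zero hk) (by simpa using h)

/-- `₂F₁(-N, -2N - 1/3; 2/3; -8) = (-27) ^ N`. -/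
theorem sum_termNegEight_neg (N : ℕ) {K : ℕ} (hK : N < K) :
    ∑ k ∈ Finset.range K, termNegEight (-N) k = (-27) ^ N := by
  induction N with
  | zero => exact sum_termNegEight_zero hK (by simp)
  | succ N ih =>
    have e := sum_termNegEight_telescope (-((N + 1 : ℕ) : ℚ)) K
    rw [termNegEight_eq_zero hK (by left; ring), zero_mul, mul_eq_zero] at e
    push_cast at e ⊢
    rw [show (-(N + 1) + 1 : ℚ) = -N by ring, ih (by omega)] at e
    rcases e with e | e
    · linear_combination e
    · exfalso
      simp only [mul_eq_zero] at e
      have : (0 : ℚ) ≤ N := by positivity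
      rcases e with (e | e) | e <;> linarith

/-- `₂F₁(1/6 - h, -2h; 2/3; -8) = (-27) ^ h`. -/
theorem sum_termNegEight_sixth_sub (h : ℕ) {K : ℕ} (hK : 2 * h < K) :
    ∑ k ∈ Finset.range K, termNegEight (1 / 6 - h) k = (-27) ^ h := by
  induction h with
  | zero => exact sum_termNegEight_zero hK (by norm_num)
  | succ h ih =>
    have e := sum_termNegEight_telescope (1 / 6 - ((h + 1 : ℕ) : ℚ)) K
    rw [termNegEight_eq_zero hK (by right; push_cast; ring), zero_mul, mul_eq_zero] at e
    push_cast at e ⊢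
    rw [show (1 / 6 - (h + 1) + 1 : ℚ) = 1 / 6 - h by ring, ih (by omega)] at e
    rcases e with e | e
    · linear_combination e
    · exfalso
      simp only [mul_eq_zero] at e
      have : (0 : ℚ) ≤ h := by positivity
      rcases e with (e | e) | e <;> linarith

/-- A closed form for `₂F₁(-N, 1/3 - N; 4/3 + N; -1/8)`. -/
theorem sum_termNegEighth_neg (N : ℕ) {K : ℕ} (hK : N < K) :
    ∑ k ∈ Finset.range K, termNegEighth (-N) k =
      ∏ i ∈ Finset.range N, (27 / 16 * (3 * i + 4) / (6 * i + 7) : ℚ) := by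
  induction N with
  | zero => simpa using sum_termNegEighth_zero hK (a := 0) (by simp)
  | succ N ih =>
    have e := sum_termNegEighth_telescope (a := -((N + 1 : ℕ) : ℚ))
      (fun k => by
        have : (0 : ℚ) ≤ N := by positivity
        have : (0 : ℚ) ≤ k := by positivity
        push_cast
        apply ne_of_gt
        linarith) K
    rw [termNegEighth_eq_zero hK (by left; ring), zero_mul, mul_eq_zero] at e
    rw [Finset.prod_range_succ, ← ih (by omega)]
    push_cast at e ⊢
    rw [show (-(N + 1) + 1 : ℚ) = -N by ring] at e
    rcases e with e | e
    · have : (6 * N + 7 : ℚ) ≠ 0 := by positivity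
      field_simp
      linear_combination 3 * e
    · exfalso
      simp only [mul_eq_zero] at e
      have : (0 : ℚ) ≤ N := by positivity
      rcases e with e | e <;> linarith

/-- A closed form for `₂F₁(-n - 1/3, -n; 5/3 + n; -1/8)`. -/
theorem sum_termNegEighth_neg_sub_third (n : ℕ) {K : ℕ} (hK : n < K) :
    ∑ k ∈ Finset.range K, termNegEighth (-n - 1 / 3) k =
      ∏ i ∈ Finset.range n, (9 / 16 * (3 * i + 5) / (2 * i + 3) : ℚ) := by
  induction n with
  | zero => simpa using sum_termNegEighth_zero hK (a := 0 - 1 / 3) (by norm_num)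
  | succ n ih =>
    have e := sum_termNegEighth_telescope (a := -((n + 1 : ℕ) : ℚ) - 1 / 3)
      (fun k => by
        have : (0 : ℚ) ≤ n := by positivity
        have : (0 : ℚ) ≤ k := by positivity
        push_cast
        apply ne_of_gt
        linarith) K
    rw [termNegEighth_eq_zero hK (by right; ring), zero_mul, mul_eq_zero] at e
    rw [Finset.prod_range_succ, ← ih (by omega)]
    push_cast at e ⊢
    rw [show (-(n + 1) - 1 / 3 + 1 : ℚ) = -n - 1 / 3 by ring] at e
    rcases e with e | e
    · have : (2 * n + 3 : ℚ) ≠ 0 := by positivity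
      generalize ∑ k ∈ Finset.range K, termNegEighth (-n - 1 / 3) k = x at e ⊢
      generalize ∑ k ∈ Finset.range K, termNegEighth (-(n + 1) - 1 / 3) k = y at e ⊢
      field_simp
      linear_combination e
    · exfalso
      simp only [mul_eq_zero] at e
      have : (0 : ℚ) ≤ n := by positivity
      rcases e with e | e <;> linarith

theorem termNegEight_half (k : ℕ) :
    termNegEight (1 / 2) k = ((2 * k).choose k : ℚ) * (-2) ^ k := by
  rw [← Nat.centralBinom_eq_two_mul_choose]
  induction k with
  | zero => simp [termNegEight]
  | succ k ih =>
    have h1 : (2 / 3 + k : ℚ) * (1 + k) ≠ 0 := by positivity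
    have e := termNegEight_succ (1 / 2) k
    have c : ((k + 1 : ℚ)) * (k + 1).centralBinom = 2 * (2 * k + 1) * k.centralBinom := by
      exact_mod_cast Nat.succ_mul_centralBinom_succ k
    refine mul_right_cancel₀ h1 ?_
    rw [e, ih, pow_succ]
    linear_combination 2 * (-2) ^ k * (2 / 3 + k : ℚ) * c

theorem termNegEighth_half (k : ℕ) :
    termNegEighth (1 / 2) k = ((2 * k).choose k : ℚ) / (-32) ^ k := by
  rw [← Nat.centralBinom_eq_two_mul_choose]
  induction k with
  | zero => simp [termNegEighth]
  | succ k ih =>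
    have h0 : (4 / 3 - 1 / 2 + k : ℚ) ≠ 0 := by norm_num; positivity
    have h1 : (1 + k : ℚ) ≠ 0 := by positivity
    have e := termNegEighth_succ h0
    have c : ((k + 1 : ℚ)) * (k + 1).centralBinom = 2 * (2 * k + 1) * k.centralBinom := by
      exact_mod_cast Nat.succ_mul_centralBinom_succ k
    have hp : (-32 : ℚ) ^ k ≠ 0 := by positivity
    refine mul_right_cancel₀ (mul_ne_zero h0 h1) ?_
    rw [e, ih, pow_succ]
    rw [div_mul_eq_mul_div, div_mul_eq_mul_div, div_eq_div_iff hp (by positivity)]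
    linear_combination (-(5 / 6 + k : ℚ) * (-32) ^ k) * c

open Finset in
/-- The product `(1 + x) (1 + x / 2) ⋯ (1 + x / m)`. -/
def harmonicProd (x : ℚ) (m : ℕ) : ℚ := ∏ i ∈ range m, (1 + x / (i + 1))

open Finset in
theorem prod_add_mul_eq_harmonicProd (x : ℚ) {d : ℚ} (hd : d ≠ 0) (m : ℕ) :
    ∏ i ∈ range m, (x + d * (i + 1)) = d ^ m * m.factorial * harmonicProd (x / d) m := by
  rw [harmonicProd, ← prod_range_add_one_eq_factorial]
  push_cast
  rw [← card_range m, ← prod_const, card_range, ← prod_mul_distrib, ← prod_mul_distrib]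
  refine prod_congr rfl fun i _ => ?_
  have : (i + 1 : ℚ) ≠ 0 := by positivity
  field_simp
  ring

open Finset in
theorem prod_progression (x : ℚ) {d : ℚ} (hd : d ≠ 0) (m q : ℕ) :
    ∏ i ∈ range (m + 1 + q), (x - d * m + d * i) =
      x * ((-d) ^ m * m.factorial * harmonicProd (x / -d) m) *
        (d ^ q * q.factorial * harmonicProd (x / d) q) := by
  rw [← prod_add_mul_eq_harmonicProd x hd, ← prod_add_mul_eq_harmonicProd x (neg_ne_zero.2 hd),
    prod_range_add, prod_range_succ, ← prod_range_reflect]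
  have e1 : ∏ j ∈ range m, (x - d * m + d * ((m - 1 - j : ℕ) : ℚ)) =
      ∏ i ∈ range m, (x + -d * (i + 1)) := by
    refine prod_congr rfl fun i hi => ?_
    have hi := mem_range.1 hi
    rw [Nat.sub_sub, Nat.cast_sub (by omega)]
    push_cast
    ring
  have e2 : ∏ i ∈ range q, (x - d * m + d * ((m + 1 + i : ℕ) : ℚ)) =
      ∏ i ∈ range q, (x + d * (i + 1)) :=
    prod_congr rfl fun i hi => by push_cast; ring
  rw [e1, e2]
  ring

open Finset in
theorem factorial_add_eq_harmonicProd (m n : ℕ) :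
    ((m + n).factorial : ℚ) =
      n.factorial * ((-1) ^ m * m.factorial * harmonicProd (-(m + n + 1)) m) := by
  have h := prod_add_mul_eq_harmonicProd (m + n + 1) (d := -1) (by norm_num) m
  rw [div_neg, div_one] at h
  rw [← h, ← prod_range_reflect, ← prod_range_add_one_eq_factorial,
    ← prod_range_add_one_eq_factorial, add_comm m n, prod_range_add]
  push_cast
  congr 1
  refine prod_congr rfl fun i hi => ?_
  have hi := mem_range.1 hi
  rw [Nat.sub_sub, Nat.cast_sub (by omega)]
  push_cast
  ring

open Finset in
theorem factorial_two_mul_eq_prod_odd (m : ℕ) :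
    ((2 * m).factorial : ℚ) = 2 ^ m * m.factorial * ∏ i ∈ range m, (2 * i + 1 : ℚ) := by
  induction m with
  | zero => simp
  | succ m ih =>
    rw [prod_range_succ, show 2 * (m + 1) = 2 * m + 1 + 1 by ring, Nat.factorial_succ,
      Nat.factorial_succ, Nat.factorial_succ]
    push_cast
    rw [ih]
    ring

open Finset in
theorem factorial_duplication (m n : ℕ) :
    (-4) ^ m * m.factorial * (m + n).factorial * harmonicProd ((2 * (m + n) + 1) / -2) (m + n) =
      n.factorial * harmonicProd ((2 * (m + n) + 1) / -2) n * ((2 * m).factorial : ℚ) := by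
  have h1 := prod_add_mul_eq_harmonicProd (2 * (m + n) + 1) (d := -2) (by norm_num) (n + m)
  have h2 := prod_add_mul_eq_harmonicProd (2 * (m + n) + 1) (d := -2) (by norm_num) n
  rw [prod_range_add, h2] at h1
  have e : ∏ i ∈ range m, (2 * (m + n) + 1 + -2 * (((n + i : ℕ) : ℚ) + 1)) =
      ∏ i ∈ range m, (2 * i + 1 : ℚ) := by
    rw [← prod_range_reflect]
    refine prod_congr rfl fun i hi => ?_
    have hi := mem_range.1 hi
    push_cast
    rw [Nat.sub_sub, Nat.cast_sub (by omega)]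
    push_cast
    ring
  rw [e, add_comm n m, pow_add] at h1
  have h3 : (-2 : ℚ) ^ n ≠ 0 := by positivity
  rw [factorial_two_mul_eq_prod_odd, show (-4 : ℚ) = 2 * -2 by norm_num, mul_pow]
  refine mul_left_cancel₀ h3 ?_
  linear_combination (-2 ^ m * (m.factorial : ℚ)) * h1

section

variable {p : ℕ} [hpp : Fact p.Prime]

theorem inv_natCast_mem_pIntegral_of_lt {m : ℕ} (h0 : 0 < m) (hm : m < p) :
    (m : ℚ)⁻¹ ∈ pIntegral p :=
  inv_natCast_mem_pIntegral (Nat.not_dvd_of_pos_of_lt h0 hm)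

theorem hasLog_harmonicProd {t : ℚ} (ht : t ∈ pIntegral p) {m : ℕ} (hm : m < p) :
    HasLog p (harmonicProd (p * t) m) (t * harmonic m) := by
  rw [harmonicProd, harmonic, Finset.mul_sum]
  refine HasLog.prod fun i hi => ?_
  have hi := Finset.mem_range.1 hi
  have h : ((i + 1 : ℕ) : ℚ)⁻¹ ∈ pIntegral p := inv_natCast_mem_pIntegral_of_lt (by omega) (by omega)
  have := HasLog.one_add (mul_mem ht h)
  convert this using 2
  push_cast
  ring

theorem harmonic_add (m n : ℕ) :
    harmonic (m + n) = harmonic m + ∑ i ∈ Finset.range n, ((m + i + 1 : ℕ) : ℚ)⁻¹ := by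
  rw [harmonic, Finset.sum_range_add, ← harmonic]

theorem inv_add_inv_congr_zero {x y : ℕ} (hx : 0 < x) (hy : 0 < y) (hxy : x + y = p) :
    CongrModPrime p ((x : ℚ)⁻¹ + (y : ℚ)⁻¹) 0 := by
  refine ⟨(x : ℚ)⁻¹ * (y : ℚ)⁻¹, mul_mem (inv_natCast_mem_pIntegral_of_lt hx (by omega))
    (inv_natCast_mem_pIntegral_of_lt hy (by omega)), ?_⟩
  have hx' : (x : ℚ) ≠ 0 := by positivity
  have hy' : (y : ℚ) ≠ 0 := by positivity
  rw [← hxy]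
  push_cast
  field_simp
  ring

theorem CongrModPrime.sum_zero {ι : Type*} {s : Finset ι} {f : ι → ℚ}
    (h : ∀ i ∈ s, CongrModPrime p (f i) 0) : CongrModPrime p (∑ i ∈ s, f i) 0 := by
  classical
  induction s using Finset.induction_on with
  | empty => exact ⟨0, zero_mem _, by simp⟩
  | insert a s ha ih =>
    obtain ⟨z, hz, e⟩ := h a (by simp)
    obtain ⟨w, hw, e'⟩ := ih fun i hi => h i (by simp [hi])
    exact ⟨z + w, add_mem hz hw, by rw [Finset.sum_insert ha]; linear_combination e + e'⟩

theorem half_mem_pIntegral (hp : p ≠ 2) : (1 / 2 : ℚ) ∈ pIntegral p := by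
  have := inv_natCast_mem_pIntegral (p := p) (m := 2)
    fun h => hp ((Nat.prime_dvd_prime_iff_eq hpp.out Nat.prime_two).1 h)
  simpa using this

theorem harmonic_reflect (hp : p ≠ 2) {m n : ℕ} (h : 2 * m + n + 1 = p) :
    CongrModPrime p (harmonic (m + n)) (harmonic m) := by
  have h2 : CongrModPrime p (∑ i ∈ Finset.range n,
      (((m + i + 1 : ℕ) : ℚ)⁻¹ + ((m + (n - 1 - i) + 1 : ℕ) : ℚ)⁻¹)) 0 :=
    CongrModPrime.sum_zero fun i hi => by
      have hi := Finset.mem_range.1 hi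
      exact inv_add_inv_congr_zero (by omega) (by omega) (by omega)
  obtain ⟨z, hz, e⟩ := h2
  rw [Finset.sum_add_distrib,
    Finset.sum_range_reflect (fun i => ((m + i + 1 : ℕ) : ℚ)⁻¹)] at e
  refine ⟨1 / 2 * z, mul_mem (half_mem_pIntegral hp) hz, ?_⟩
  rw [harmonic_add]
  linear_combination e / 2

theorem harmonic_two_mul (m : ℕ) :
    2 * harmonic (2 * m) = harmonic m + 2 * ∑ i ∈ Finset.range m, ((2 * i + 1 : ℕ) : ℚ)⁻¹ := by
  induction m with
  | zero => simp
  | succ m ih =>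
    rw [show 2 * (m + 1) = 2 * m + 1 + 1 by ring, harmonic_succ, harmonic_succ, harmonic_succ,
      Finset.sum_range_succ]
    have h : 2 * ((2 * m + 1 + 1 : ℕ) : ℚ)⁻¹ = ((m + 1 : ℕ) : ℚ)⁻¹ := by
      push_cast
      rw [show (2 * m + 1 + 1 : ℚ) = 2 * (m + 1) by ring]
      field_simp
    linear_combination ih + h

theorem harmonic_duplication {m n : ℕ} (h : 2 * (m + n) + 1 = p) :
    CongrModPrime p (2 * harmonic (2 * m)) (harmonic m - (harmonic (m + n) - harmonic n)) := by
  have h2 : CongrModPrime p (∑ i ∈ Finset.range m,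
      (((2 * i + 1 : ℕ) : ℚ)⁻¹ + ((2 * (n + (m - 1 - i) + 1) : ℕ) : ℚ)⁻¹)) 0 :=
    CongrModPrime.sum_zero fun i hi => by
      have hi := Finset.mem_range.1 hi
      exact inv_add_inv_congr_zero (by omega) (by omega) (by omega)
  obtain ⟨z, hz, e⟩ := h2
  rw [Finset.sum_add_distrib,
    Finset.sum_range_reflect (fun i => ((2 * (n + i + 1) : ℕ) : ℚ)⁻¹)] at e
  have e2 : ∑ i ∈ Finset.range m, ((2 * (n + i + 1) : ℕ) : ℚ)⁻¹ =
      1 / 2 * ∑ i ∈ Finset.range m, ((n + i + 1 : ℕ) : ℚ)⁻¹ := by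
    rw [Finset.mul_sum]
    refine Finset.sum_congr rfl fun i _ => ?_
    rw [Nat.cast_mul, mul_inv]
    norm_num
  rw [e2] at e
  refine ⟨2 * z, mul_mem (natCast_mem _ 2) hz, ?_⟩
  rw [harmonic_two_mul, add_comm m n, harmonic_add]
  linear_combination 2 * e

theorem hasLog_intCast {n : ℤ} (h : (n : ZMod p) = 1) : ∃ l, HasLog p n l := by
  have h1 : ((n - 1 : ℤ) : ZMod p) = 0 := by push_cast; rw [h, sub_self]
  obtain ⟨c, hc⟩ := (ZMod.intCast_zmod_eq_zero_iff_dvd _ p).1 h1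
  refine ⟨c, intCast_mem _ c, 0, zero_mem _, ?_⟩
  have : (n : ℚ) - 1 = p * c := by exact_mod_cast hc
  linear_combination this

theorem isSquare_neg_three (h : p % 3 = 1) : IsSquare (-3 : ZMod p) := by
  have : Fact (Nat.Prime 3) := ⟨Nat.prime_three⟩
  have hdvd : 3 ∣ Fintype.card (ZMod p)ˣ := by
    rw [ZMod.card_units]
    have := hpp.out.one_lt
    omega
  obtain ⟨u, hu⟩ := exists_prime_orderOf_dvd_card 3 hdvd
  have h3 : (u : ZMod p) ^ 3 = 1 := by
    rw [← Units.val_pow_eq_pow_val, ← hu, pow_orderOf_eq_one, Units.val_one]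
  have h1 : (u : ZMod p) - 1 ≠ 0 := by
    intro h
    have : u = 1 := Units.ext (by simpa using sub_eq_zero.1 h)
    simp [this] at hu
  refine ⟨2 * u + 1, ?_⟩
  have : (u : ZMod p) ^ 2 + u + 1 = 0 := mul_left_cancel₀ h1 (by linear_combination h3)
  linear_combination (-4) * this

theorem exists_hasLog_neg_three_pow (h : p % 3 = 1) (h2 : p ≠ 2) :
    ∃ l, HasLog p ((-3) ^ (p / 2)) l := by
  have h3 : (-3 : ZMod p) ≠ 0 := by
    rw [neg_ne_zero]
    intro h0
    have : ((3 : ℕ) : ZMod p) = 0 := by exact_mod_cast h0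
    have := (Nat.prime_dvd_prime_iff_eq hpp.out Nat.prime_three).1
      ((ZMod.natCast_eq_zero_iff 3 p).1 this)
    subst this
    omega
  have h4 := (ZMod.euler_criterion p h3).1 (isSquare_neg_three h)
  simpa using hasLog_intCast (p := p) (n := (-3) ^ (p / 2)) (by push_cast; exact h4)

theorem exists_hasLog_two_pow (h2 : p ≠ 2) :
    ∃ l, HasLog p (legendreSym p 2 * 2 ^ (p / 2)) l := by
  have h0 : ((2 : ℤ) : ZMod p) ≠ 0 := by
    intro h0
    have : ((2 : ℕ) : ZMod p) = 0 := by exact_mod_cast h0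
    exact h2 ((Nat.prime_dvd_prime_iff_eq hpp.out Nat.prime_two).1
      ((ZMod.natCast_eq_zero_iff 2 p).1 this))
  have h := legendreSym.eq_pow p 2
  have hs := legendreSym.sq_one p h0
  have := hasLog_intCast (p := p) (n := legendreSym p 2 * 2 ^ (p / 2)) (by
    push_cast at h ⊢
    rw [← h, ← pow_two]
    exact_mod_cast congrArg (Int.cast : ℤ → ZMod p) hs)
  simpa using this

end

open Finset in
theorem prod_three_mul_add_four_div (r : ℕ) {x : ℚ} (hx : x = 6 * r + 1) :
    (∏ i ∈ range (3 * r), (27 / 16 * (3 * i + 4) / (6 * i + 7) : ℚ)) *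
        (harmonicProd (x * (-1 / 6)) r * harmonicProd (x * (1 / 6)) (2 * r)) =
      ((-3) ^ (3 * r)) ^ 3 / (2 ^ (3 * r)) ^ 5 *
        (harmonicProd (x * (-1 / 3)) (2 * r) * harmonicProd (x * (1 / 3)) r) := by
  have h1 : ∏ i ∈ range (3 * r), (3 * i + 4 : ℚ) =
      ∏ i ∈ range (2 * r + 1 + r), (x - 3 * ((2 * r : ℕ) : ℚ) + 3 * i) := by
    rw [show 2 * r + 1 + r = 3 * r + 1 by ring, prod_range_succ']
    simp only [hx]
    push_cast
    rw [show (6 * r + 1 - 3 * (2 * r) + 3 * 0 : ℚ) = 1 by ring, mul_one]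
    exact prod_congr rfl fun i _ => by ring
  have h2 : ∏ i ∈ range (3 * r), (6 * i + 7 : ℚ) =
      ∏ i ∈ range (r + 1 + 2 * r), (x - 6 * (r : ℚ) + 6 * i) := by
    rw [show r + 1 + 2 * r = 3 * r + 1 by ring, prod_range_succ']
    simp only [hx]
    push_cast
    rw [show (6 * r + 1 - 6 * r + 6 * 0 : ℚ) = 1 by ring, mul_one]
    exact prod_congr rfl fun i _ => by ring
  have h3 : ∏ i ∈ range (3 * r), (6 * i + 7 : ℚ) ≠ 0 :=
    prod_ne_zero_iff.2 fun i _ => by positivity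
  rw [prod_div_distrib, prod_mul_distrib, prod_const, card_range, div_mul_eq_mul_div,
    div_mul_eq_mul_div, div_eq_div_iff h3 (by positivity), h1, h2,
    prod_progression x (by norm_num), prod_progression x (by norm_num),
    show x / 3 = x * (1 / 3) by ring, show x / -3 = x * (-1 / 3) by ring,
    show x / 6 = x * (1 / 6) by ring, show x / -6 = x * (-1 / 6) by ring]
  have hc : (27 / 16 : ℚ) ^ (3 * r) * ((-3) ^ (2 * r) * 3 ^ r) * (2 ^ (3 * r)) ^ 5 =
      ((-3) ^ (3 * r)) ^ 3 * ((-6) ^ r * 6 ^ (2 * r)) := by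
    rw [← pow_mul, ← pow_mul, mul_right_comm 3 r 5, mul_right_comm 3 r 3]
    simp only [pow_mul, ← mul_pow]
    norm_num
  linear_combination (x * (2 * r).factorial * harmonicProd (x * (-1 / 3)) (2 * r) *
    r.factorial * harmonicProd (x * (1 / 3)) r * harmonicProd (x * (-1 / 6)) r *
    harmonicProd (x * (1 / 6)) (2 * r)) * hc

open Finset in
theorem prod_three_mul_add_five_div (r : ℕ) {x : ℚ} (hx : x = 6 * r + 1) :
    (∏ i ∈ range (5 * r), (9 / 16 * (3 * i + 5) / (2 * i + 3) : ℚ)) *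
        (((3 * r).factorial * harmonicProd (x * (-1 / 2)) (3 * r)) *
          ((2 * r).factorial * harmonicProd (x * (1 / 2)) (2 * r))) =
      (-1) ^ r * 3 ^ (15 * r) / 2 ^ (25 * r) *
        (((4 * r).factorial * harmonicProd (x * (-2 / 3)) (4 * r)) *
          (r.factorial * harmonicProd (x * (2 / 3)) r)) := by
  have h1 : 2 * ∏ i ∈ range (5 * r), (3 * i + 5 : ℚ) =
      ∏ i ∈ range (4 * r + 1 + r), (2 * x - 3 * ((4 * r : ℕ) : ℚ) + 3 * i) := by
    rw [show 4 * r + 1 + r = 5 * r + 1 by ring, prod_range_succ']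
    simp only [hx]
    push_cast
    rw [show (2 * (6 * r + 1) - 3 * (4 * r) + 3 * 0 : ℚ) = 2 by ring, mul_comm]
    congr 1
    exact prod_congr rfl fun i _ => by ring
  have h2 : ∏ i ∈ range (5 * r), (2 * i + 3 : ℚ) =
      ∏ i ∈ range (3 * r + 1 + 2 * r), (x - 2 * ((3 * r : ℕ) : ℚ) + 2 * i) := by
    rw [show 3 * r + 1 + 2 * r = 5 * r + 1 by ring, prod_range_succ']
    simp only [hx]
    push_cast
    rw [show (6 * r + 1 - 2 * (3 * r) + 2 * 0 : ℚ) = 1 by ring, mul_one]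
    exact prod_congr rfl fun i _ => by ring
  have h3 : ∏ i ∈ range (5 * r), (2 * i + 3 : ℚ) ≠ 0 :=
    prod_ne_zero_iff.2 fun i _ => by positivity
  rw [prod_progression (2 * x) (by norm_num), show 2 * x / 3 = x * (2 / 3) by ring,
    show 2 * x / -3 = x * (-2 / 3) by ring] at h1
  rw [prod_div_distrib, prod_mul_distrib, prod_const, card_range, div_mul_eq_mul_div,
    div_mul_eq_mul_div, div_eq_div_iff h3 (by positivity), h2,
    prod_progression x (by norm_num),
    show x / 2 = x * (1 / 2) by ring, show x / -2 = x * (-1 / 2) by ring]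
  have hc : (9 / 16 : ℚ) ^ (5 * r) * ((-3) ^ (4 * r) * 3 ^ r) * 2 ^ (25 * r) =
      (-1) ^ r * 3 ^ (15 * r) * ((-2) ^ (3 * r) * 2 ^ (2 * r)) := by
    simp only [pow_mul, ← mul_pow]
    norm_num
  linear_combination ((9 / 16 : ℚ) ^ (5 * r) * ((3 * r).factorial *
      harmonicProd (x * (-1 / 2)) (3 * r) * (2 * r).factorial *
      harmonicProd (x * (1 / 2)) (2 * r)) * 2 ^ (25 * r)) / 2 * h1 +
    (x * (4 * r).factorial * harmonicProd (x * (-2 / 3)) (4 * r) * r.factorial *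
      harmonicProd (x * (2 / 3)) r * (3 * r).factorial * harmonicProd (x * (-1 / 2)) (3 * r) *
      (2 * r).factorial * harmonicProd (x * (1 / 2)) (2 * r)) * hc

theorem factorial_six_mul_eq (r : ℕ) {x : ℚ} (hx : x = 6 * r + 1) :
    ((6 * r).factorial : ℚ) =
      (4 * r).factorial * ((2 * r).factorial * harmonicProd (x * -1) (2 * r)) := by
  have h := factorial_add_eq_harmonicProd (2 * r) (4 * r)
  have e : (-(((2 * r : ℕ) : ℚ) + ((4 * r : ℕ) : ℚ) + 1)) = x * -1 := by
    rw [hx]; push_cast; ring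
  rw [e, (even_two_mul r).neg_one_pow, one_mul, show 2 * r + 4 * r = 6 * r by ring] at h
  exact h

theorem factorial_six_mul_eq_sq (r : ℕ) {x : ℚ} (hx : x = 6 * r + 1) :
    ((6 * r).factorial : ℚ) =
      (-1) ^ r * (3 * r).factorial ^ 2 * harmonicProd (x * -1) (3 * r) := by
  have h := factorial_add_eq_harmonicProd (3 * r) (3 * r)
  have e : (-(((3 * r : ℕ) : ℚ) + ((3 * r : ℕ) : ℚ) + 1)) = x * -1 := by
    rw [hx]; push_cast; ring
  rw [e, show 3 * r + 3 * r = 6 * r by ring, pow_mul (-1 : ℚ) 3 r] at h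
  rw [h]
  norm_num
  ring

theorem factorial_two_mul_sq (r : ℕ) {x : ℚ} (hx : x = 6 * r + 1) :
    (-4) ^ r * r.factorial * (3 * r).factorial * harmonicProd (x * (-1 / 2)) (3 * r) =
      (2 * r).factorial ^ 2 * harmonicProd (x * (-1 / 2)) (2 * r) := by
  have h := factorial_duplication r (2 * r)
  have e : (2 * ((r : ℚ) + ((2 * r : ℕ) : ℚ)) + 1) / -2 = x * (-1 / 2) := by
    rw [hx]; push_cast; ring
  rw [e, show r + 2 * r = 3 * r by ring] at h
  rw [h]
  ring

theorem two_pow_sq_mul_harmonicProd (r : ℕ) {x : ℚ} (hx : x = 6 * r + 1) :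
    (2 ^ (3 * r)) ^ 2 * harmonicProd (x * (-1 / 2)) (3 * r) = harmonicProd (x * -1) (3 * r) := by
  have h := factorial_duplication (3 * r) 0
  have e : (2 * (((3 * r : ℕ) : ℚ) + ((0 : ℕ) : ℚ)) + 1) / -2 = x * (-1 / 2) := by
    rw [hx]; push_cast; ring
  rw [e, add_zero, show 2 * (3 * r) = 6 * r by ring, factorial_six_mul_eq_sq r hx,
    show harmonicProd (x * (-1 / 2)) 0 = 1 by simp [harmonicProd], pow_mul,
    show ((-4 : ℚ) ^ 3) = (-1) * 4 ^ 3 by norm_num, mul_pow] at h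
  have h0 : (-1 : ℚ) ^ r * (3 * r).factorial ^ 2 ≠ 0 := by positivity
  refine mul_left_cancel₀ h0 ?_
  rw [← pow_mul, mul_right_comm 3 r 2, pow_mul, show ((2 : ℚ) ^ (3 * 2)) = 4 ^ 3 by norm_num]
  simp only [Nat.factorial_zero, Nat.cast_one, one_mul] at h
  linear_combination h

theorem prod_three_mul_add_five_div' (r : ℕ) {x : ℚ} (hx : x = 6 * r + 1) :
    (∏ i ∈ Finset.range (5 * r), (9 / 16 * (3 * i + 5) / (2 * i + 3) : ℚ)) *
        (harmonicProd (x * (-1 / 2)) (3 * r) * harmonicProd (x * (1 / 2)) (2 * r) *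
          (harmonicProd (x * -1) (2 * r) * harmonicProd (x * (-1 / 2)) (3 * r))) =
      ((-3) ^ (3 * r)) ^ 5 / (2 ^ (3 * r)) ^ 9 *
        (harmonicProd (x * (-2 / 3)) (4 * r) * harmonicProd (x * (2 / 3)) r *
          (harmonicProd (x * -1) (3 * r) * harmonicProd (x * (-1 / 2)) (2 * r))) := by
  have e := prod_three_mul_add_five_div r hx
  have a := (factorial_six_mul_eq r hx).symm.trans (factorial_six_mul_eq_sq r hx)
  have b := factorial_two_mul_sq r hx
  generalize ∏ i ∈ Finset.range (5 * r), (9 / 16 * (3 * i + 5) / (2 * i + 3) : ℚ) = G at e ⊢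
  have f2 : ((2 * r).factorial : ℚ) ≠ 0 := by positivity
  have f3 : ((3 * r).factorial : ℚ) ≠ 0 := by positivity
  have hw : (((4 * r).factorial : ℚ) * r.factorial) * (4 ^ r *
      (harmonicProd (x * -1) (2 * r) * harmonicProd (x * (-1 / 2)) (3 * r))) =
      ((3 * r).factorial * (2 * r).factorial) *
        (harmonicProd (x * -1) (3 * r) * harmonicProd (x * (-1 / 2)) (2 * r)) := by
    have s : ((-4 : ℚ)) ^ r = (-1) ^ r * 4 ^ r := by rw [← mul_pow]; norm_num
    have s2 : ((-1 : ℚ)) ^ r * (-1) ^ r = 1 := by rw [← mul_pow]; norm_num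
    rw [s] at b
    refine mul_left_cancel₀ (mul_ne_zero f2 f3) ?_
    generalize harmonicProd (x * -1) (2 * r) = y1 at *
    generalize harmonicProd (x * (-1 / 2)) (3 * r) = y2 at *
    generalize harmonicProd (x * -1) (3 * r) = y3 at *
    generalize harmonicProd (x * (-1 / 2)) (2 * r) = y4 at *
    linear_combination (4 ^ r * (r.factorial : ℚ) * (3 * r).factorial * y2) * a +
      (3 * r).factorial ^ 2 * y3 * b
  have hc : (-1 : ℚ) ^ r * 3 ^ (15 * r) / 2 ^ (25 * r) =
      ((-3) ^ (3 * r)) ^ 5 / (2 ^ (3 * r)) ^ 9 * 4 ^ r := by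
    rw [div_mul_eq_mul_div, div_eq_div_iff (by positivity) (by positivity), ← pow_mul, ← pow_mul,
      mul_right_comm 3 r 5, mul_right_comm 3 r 9]
    simp only [pow_mul, ← mul_pow]
    norm_num
  rw [hc] at e
  refine mul_left_cancel₀ (mul_ne_zero f2 f3) ?_
  linear_combination (harmonicProd (x * -1) (2 * r) * harmonicProd (x * (-1 / 2)) (3 * r)) * e +
    ((-3) ^ (3 * r)) ^ 5 / (2 ^ (3 * r)) ^ 9 *
      (harmonicProd (x * (-2 / 3)) (4 * r) * harmonicProd (x * (2 / 3)) r) * hw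

section

variable {p : ℕ} [hpp : Fact p.Prime]

theorem affineModSq_termNegEight {r : ℕ} (hp : p = 6 * r + 1) (hr : 0 < r) {k : ℕ}
    (hk : k ≤ 4 * r) : AffineModSq p fun t => termNegEight (1 / 2 + p * t) k := by
  unfold termNegEight
  refine AffineModSq.prod fun j hj => ?_
  have hj := Finset.mem_range.1 hj
  have half : (1 / 2 : ℚ) ∈ pIntegral p := half_mem_pIntegral (by omega)
  have third : ((3 : ℕ) : ℚ)⁻¹ ∈ pIntegral p :=
    inv_natCast_mem_pIntegral_of_lt (by omega) (by omega)
  have e1 : (2 / 3 + j : ℚ) = (2 : ℕ) * ((3 : ℕ) : ℚ)⁻¹ + j := by push_cast; ring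
  have m1 : (2 / 3 + j : ℚ) ∈ pIntegral p := by
    rw [e1]
    exact add_mem (mul_mem (natCast_mem _ _) third) (natCast_mem _ _)
  have m2 : (2 / 3 + j : ℚ)⁻¹ ∈ pIntegral p := by
    have h : ¬ p ∣ 3 * j + 2 := by
      rintro ⟨c, hc⟩
      have : c < 2 := by
        by_contra! h
        have := Nat.mul_le_mul_left p h
        omega
      interval_cases c <;> omega
    rw [show (2 / 3 + j : ℚ)⁻¹ = (3 : ℕ) * ((3 * j + 2 : ℕ) : ℚ)⁻¹ by push_cast; field_simp; ring]
    exact mul_mem (natCast_mem _ _) (inv_natCast_mem_pIntegral h)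
  have m3 : (1 + j : ℚ)⁻¹ ∈ pIntegral p := by
    have := inv_natCast_mem_pIntegral_of_lt (p := p) (m := 1 + j) (by omega) (by omega)
    push_cast at this
    exact this
  have l1 := AffineModSq.linear (add_mem half (natCast_mem (pIntegral p) j)) (one_mem _)
  have l2 := AffineModSq.linear m1 (natCast_mem (pIntegral p) 2)
  have l3 := AffineModSq.const (neg_mem (natCast_mem (pIntegral p) 8))
  convert (((l1.mul l2).mul (AffineModSq.const m2)).mul (AffineModSq.const m3)).mul l3 using 2
  push_cast
  ring

theorem affineModSq_termNegEighth {r : ℕ} (hp : p = 6 * r + 1) (hr : 0 < r) {k : ℕ}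
    (hk : k ≤ 5 * r) : AffineModSq p fun t => termNegEighth (1 / 2 + p * t) k := by
  unfold termNegEighth
  refine AffineModSq.prod fun j hj => ?_
  have hj := Finset.mem_range.1 hj
  have half : (1 / 2 : ℚ) ∈ pIntegral p := half_mem_pIntegral (by omega)
  have sixth : ((6 : ℕ) : ℚ)⁻¹ ∈ pIntegral p :=
    inv_natCast_mem_pIntegral_of_lt (by omega) (by omega)
  have eighth : ((8 : ℕ) : ℚ)⁻¹ ∈ pIntegral p := by
    have := pow_mem half 3
    norm_num at this ⊢
    exact this
  have m1 : (5 / 6 + j : ℚ) ∈ pIntegral p := by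
    rw [show (5 / 6 + j : ℚ) = (5 : ℕ) * ((6 : ℕ) : ℚ)⁻¹ + j by push_cast; ring]
    exact add_mem (mul_mem (natCast_mem _ _) sixth) (natCast_mem _ _)
  have m2 : (5 / 6 + j : ℚ)⁻¹ ∈ pIntegral p := by
    have h : ¬ p ∣ 6 * j + 5 := by
      rintro ⟨c, hc⟩
      have : c < 5 := by
        by_contra! h
        have := Nat.mul_le_mul_left p h
        omega
      interval_cases c <;> omega
    rw [show (5 / 6 + j : ℚ)⁻¹ = (6 : ℕ) * ((6 * j + 5 : ℕ) : ℚ)⁻¹ by push_cast; field_simp; ring]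
    exact mul_mem (natCast_mem _ _) (inv_natCast_mem_pIntegral h)
  have m3 : (1 + j : ℚ)⁻¹ ∈ pIntegral p := by
    have := inv_natCast_mem_pIntegral_of_lt (p := p) (m := 1 + j) (by omega) (by omega)
    push_cast at this
    exact this
  have l1 := AffineModSq.linear (add_mem half (natCast_mem (pIntegral p) j)) (one_mem _)
  have l2 := AffineModSq.linear m1 (one_mem _)
  have l3 := AffineModSq.const (neg_mem eighth)
  have l4 := AffineModSq.inv_sub (by positivity) m2
  convert (((l1.mul l2).mul l4).mul (AffineModSq.const m3)).mul l3 using 2 with t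
  rw [show (4 / 3 - (1 / 2 + p * t) + j : ℚ) = 5 / 6 + j - p * t by ring]
  push_cast
  ring

theorem sum_termNegEight_half_congr_one {r : ℕ} (hp : p = 6 * r + 1) (hr : 0 < r) :
    ∃ z ∈ pIntegral p,
      ∑ k ∈ Finset.range (4 * r + 1), termNegEight (1 / 2) k - 1 = p ^ 2 * z := by
  have hF : AffineModSq p fun t => ∑ k ∈ Finset.range (4 * r + 1), termNegEight (1 / 2 + p * t) k :=
    AffineModSq.sum fun k hk =>
      affineModSq_termNegEight hp hr (by have := Finset.mem_range.1 hk; omega)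
  have half : (1 / 2 : ℚ) ∈ pIntegral p := half_mem_pIntegral (by omega)
  have third : ((3 : ℕ) : ℚ)⁻¹ ∈ pIntegral p :=
    inv_natCast_mem_pIntegral_of_lt (by omega) (by omega)
  have hpq : (p : ℚ) = 6 * r + 1 := by rw [hp]; push_cast; ring
  obtain ⟨z, hz, e⟩ := hF.interpolate (neg_mem third) (neg_mem half) (natCast_mem _ 3)
    (neg_mem (natCast_mem _ 2)) (by norm_num) (by norm_num)
  rw [show (1 / 2 + p * -((3 : ℕ) : ℚ)⁻¹) = 1 / 6 - ((2 * r : ℕ) : ℚ) by rw [hpq]; push_cast; ring,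
    show (1 / 2 + p * -(1 / 2) : ℚ) = -((3 * r : ℕ) : ℚ) by rw [hpq]; push_cast; ring,
    sum_termNegEight_sixth_sub _ (by omega), sum_termNegEight_neg _ (by omega),
    mul_zero, add_zero] at e
  obtain ⟨A, hA⟩ := exists_hasLog_neg_three_pow (p := p) (by omega) (by omega)
  rw [show p / 2 = 3 * r by omega] at hA
  have p2 : ((-27 : ℚ)) ^ (2 * r) = ((-3) ^ (3 * r)) ^ 2 := by
    rw [← pow_mul, mul_right_comm]
    simp only [pow_mul]
    norm_num
  have p3 : ((-27 : ℚ)) ^ (3 * r) = ((-3) ^ (3 * r)) ^ 3 := by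
    rw [← pow_mul, mul_right_comm]
    simp only [pow_mul]
    norm_num
  rw [p2, p3] at e
  obtain ⟨-, x, hx, ex⟩ := hA.pow 2
  obtain ⟨-, y, hy, ey⟩ := hA.pow 3
  rw [ex, ey] at e
  refine ⟨z + (3 : ℕ) * x - (2 : ℕ) * y, sub_mem (add_mem hz (mul_mem (natCast_mem _ _) hx))
    (mul_mem (natCast_mem _ _) hy), ?_⟩
  push_cast at e ⊢
  linear_combination e

theorem sum_termNegEighth_half_congr {r : ℕ} (hp : p = 6 * r + 1) (hr : 0 < r) :
    ∃ z ∈ pIntegral p, ∑ k ∈ Finset.range (5 * r + 1), termNegEighth (1 / 2) k - legendreSym p 2 =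
      p ^ 2 * z := by
  have hF : AffineModSq p fun t =>
      ∑ k ∈ Finset.range (5 * r + 1), termNegEighth (1 / 2 + p * t) k :=
    AffineModSq.sum fun k hk =>
      affineModSq_termNegEighth hp hr (by have := Finset.mem_range.1 hk; omega)
  have half : (1 / 2 : ℚ) ∈ pIntegral p := half_mem_pIntegral (by omega)
  have third : (1 / 3 : ℚ) ∈ pIntegral p := by
    have := inv_natCast_mem_pIntegral_of_lt (p := p) (m := 3) (by omega) (by omega)
    norm_num at this ⊢
    exact this
  have sixth : (1 / 6 : ℚ) ∈ pIntegral p := by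
    have := inv_natCast_mem_pIntegral_of_lt (p := p) (m := 6) (by omega) (by omega)
    norm_num at this ⊢
    exact this
  have nat (n : ℕ) : (n : ℚ) ∈ pIntegral p := natCast_mem _ n
  have hpq : (p : ℚ) = 6 * r + 1 := by rw [hp]; push_cast; ring
  obtain ⟨z, hz, e⟩ := hF.interpolate (a := (5 : ℕ) * (1 / 2)) (b := -((3 : ℕ) * (1 / 2)))
    (neg_mem half) (neg_mem (mul_mem (nat 5) sixth)) (mul_mem (nat 5) half)
    (neg_mem (mul_mem (nat 3) half)) (by norm_num) (by norm_num)
  rw [show (1 / 2 + p * -((5 : ℕ) * (1 / 6)) : ℚ) = -((5 * r : ℕ) : ℚ) - 1 / 3 by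
      rw [hpq]; push_cast; ring,
    show (1 / 2 + p * -(1 / 2) : ℚ) = -((3 * r : ℕ) : ℚ) by rw [hpq]; push_cast; ring,
    sum_termNegEighth_neg _ (by omega), sum_termNegEighth_neg_sub_third _ (by omega),
    mul_zero, add_zero] at e
  obtain ⟨A, hA⟩ := exists_hasLog_neg_three_pow (p := p) (by omega) (by omega)
  obtain ⟨B, hB⟩ := exists_hasLog_two_pow (p := p) (by omega)
  rw [show p / 2 = 3 * r by omega] at hA hB
  have hs : (legendreSym p 2 : ℚ) ^ 2 = 1 := by
    have h0 : ((2 : ℤ) : ZMod p) ≠ 0 := by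
      intro h
      have := (ZMod.intCast_zmod_eq_zero_iff_dvd 2 p).1 h
      have := Int.le_of_dvd (by norm_num) this
      omega
    exact_mod_cast legendreSym.sq_one p h0
  generalize (legendreSym p 2 : ℚ) = ε at hB hs e ⊢
  have q1 := prod_three_mul_add_four_div r hpq
  have q2 := prod_three_mul_add_five_div' r hpq
  have q3 := two_pow_sq_mul_harmonicProd r hpq
  generalize ∏ i ∈ Finset.range (3 * r), (27 / 16 * (3 * i + 4) / (6 * i + 7) : ℚ) = G₁ at *
  generalize ∏ i ∈ Finset.range (5 * r), (9 / 16 * (3 * i + 5) / (2 * i + 3) : ℚ) = G₂ at *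
  have s1 : (-1 : ℚ) ∈ pIntegral p := neg_mem (one_mem _)
  have s2 : (-1 / 2 : ℚ) ∈ pIntegral p := by simpa [neg_div] using neg_mem half
  have s3 : (-1 / 3 : ℚ) ∈ pIntegral p := by simpa [neg_div] using neg_mem third
  have s6 : (-1 / 6 : ℚ) ∈ pIntegral p := by simpa [neg_div] using neg_mem sixth
  have t3 : (2 / 3 : ℚ) ∈ pIntegral p := by
    convert mul_mem (nat 2) third using 1; norm_num
  have t3' : (-2 / 3 : ℚ) ∈ pIntegral p := by simpa [neg_div] using neg_mem t3
  have P {t : ℚ} (ht : t ∈ pIntegral p) {m : ℕ} (hm : m ≤ 4) :=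
    hasLog_harmonicProd ht (m := m * r) (by
      have := Nat.mul_le_mul_right r hm
      omega)
  have P1 {t : ℚ} (ht : t ∈ pIntegral p) := hasLog_harmonicProd ht (m := r) (by omega)
  have d1 := (P1 s6).mul (P sixth (m := 2) (by norm_num))
  have n1 := (P s3 (m := 2) (by norm_num)).mul (P1 third)
  have d2 := ((P s2 (m := 3) (by norm_num)).mul (P half (m := 2) (by norm_num))).mul
    ((P s1 (m := 2) (by norm_num)).mul (P s2 (m := 3) (by norm_num)))
  have n2 := ((P t3' (m := 4) (by norm_num)).mul (P1 t3)).mul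
    ((P s1 (m := 3) (by norm_num)).mul (P s2 (m := 2) (by norm_num)))
  have εpow {b : ℚ} : ε / b ^ 5 = 1 / (ε * b) ^ 5 ∧ ε / b ^ 9 = 1 / (ε * b) ^ 9 := by
    have h5 : ε ^ 5 = ε := by
      linear_combination (ε ^ 3 + ε) * hs
    have h9 : ε ^ 9 = ε := by
      linear_combination (ε ^ 7 + ε ^ 5 + ε ^ 3 + ε) * hs
    have hi : ε⁻¹ = ε := inv_eq_of_mul_eq_one_left ((pow_two ε).symm.trans hs)
    constructor
    · rw [mul_pow, h5, one_div, mul_inv, hi, div_eq_mul_inv]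
    · rw [mul_pow, h9, one_div, mul_inv, hi, div_eq_mul_inv]
  have L1 := ((hA.pow 3).div (hB.pow 5)).mul (n1.div d1)
  have L2 := ((hA.pow 5).div (hB.pow 9)).mul (n2.div d2)
  have E1 : ((-3) ^ (3 * r)) ^ 3 / (ε * 2 ^ (3 * r)) ^ 5 *
      ((harmonicProd (p * (-1 / 3)) (2 * r) * harmonicProd (p * (1 / 3)) r) /
        (harmonicProd (p * (-1 / 6)) r * harmonicProd (p * (1 / 6)) (2 * r))) = ε * G₁ := by
    rw [← mul_div_assoc, div_eq_iff d1.ne_zero, mul_assoc ε, q1, div_eq_mul_one_div, ← εpow.1]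
    ring
  have E2 : ((-3) ^ (3 * r)) ^ 5 / (ε * 2 ^ (3 * r)) ^ 9 *
        ((harmonicProd (p * (-2 / 3)) (4 * r) * harmonicProd (p * (2 / 3)) r *
          (harmonicProd (p * -1) (3 * r) * harmonicProd (p * (-1 / 2)) (2 * r))) /
        (harmonicProd (p * (-1 / 2)) (3 * r) * harmonicProd (p * (1 / 2)) (2 * r) *
          (harmonicProd (p * -1) (2 * r) * harmonicProd (p * (-1 / 2)) (3 * r)))) = ε * G₂ := by
    rw [← mul_div_assoc, div_eq_iff d2.ne_zero, mul_assoc ε, q2, div_eq_mul_one_div, ← εpow.2]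
    ring
  rw [E1] at L1
  rw [E2] at L2
  have L3 := (hB.pow 2).mul (P s2 (m := 3) (by norm_num))
  rw [mul_pow, hs, one_mul, q3] at L3
  obtain ⟨w, hw, ew⟩ := L3.congr_log (P s1 (m := 3) (by norm_num))
  obtain ⟨v, hv, ev⟩ := harmonic_reflect (p := p) (by omega) (m := 2 * r) (n := 2 * r) (by omega)
  obtain ⟨u, hu, eu⟩ := harmonic_duplication (p := p) (m := r) (n := 2 * r) (by omega)
  rw [show 2 * r + 2 * r = 4 * r by ring] at ev
  rw [show r + 2 * r = 3 * r by ring] at eu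
  obtain ⟨-, x, hx, ex⟩ := L1
  obtain ⟨-, y, hy, ey⟩ := L2
  have g1 : G₁ = ε * (ε * G₁) := by linear_combination (-G₁) * hs
  have g2 : G₂ = ε * (ε * G₂) := by linear_combination (-G₂) * hs
  rw [ex] at g1
  rw [ey] at g2
  have mε : ε ∈ pIntegral p := by
    rcases mul_self_eq_one_iff.1 ((pow_two ε).symm.trans hs) with h | h <;> rw [h]
    exacts [one_mem _, s1]
  refine ⟨z + ε * ((5 : ℕ) * (1 / 2) * x - (3 : ℕ) * (1 / 2) * y +
    (1 / 2 * w + v - 1 / 2 * (1 / 2) * u)), ?_, ?_⟩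
  · refine add_mem hz (mul_mem mε (add_mem (sub_mem (mul_mem (mul_mem (nat 5) half) hx)
      (mul_mem (mul_mem (nat 3) half) hy)) (sub_mem (add_mem (mul_mem half hw) hv)
      (mul_mem (mul_mem half half) hu))))
  · push_cast at e g1 g2 ew ⊢
    linear_combination e + 5 / 2 * g1 - 3 / 2 * g2 +
      ε * p * (1 / 2 * ew + ev - 1 / 4 * eu)

end

theorem theorem1 (p : ℕ) [Fact p.Prime] (hp : p ≡ 1 [MOD 3]) :
    (∑ k ∈ Finset.Icc 1 (2 * p / 3), ((2 * k).choose k : ℤ) * (-2) ^ k)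
        ≡ 0 [ZMOD ((p : ℤ) ^ 2)] ∧
    RatModEq (p ^ 2)
      (∑ k ∈ Finset.Icc 0 (5 * p / 6), ((2 * k).choose k : ℚ) / (-32) ^ k)
      ((legendreSym p 2 : ℤ) : ℚ) := by
  have hprime : p.Prime := Fact.out
  have h3 : p % 3 = 1 := hp
  obtain ⟨r, hr, hr0⟩ : ∃ r, p = 6 * r + 1 ∧ 0 < r := by
    have h1 := hprime.one_lt
    have h2 : p % 2 = 1 := by
      rcases hprime.eq_two_or_odd with h | h
      · omega
      · exact h
    exact ⟨p / 6, by omega, by omega⟩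
  have i1 : 2 * p / 3 = 4 * r := by omega
  have i2 : 5 * p / 6 = 5 * r := by omega
  rw [i1, i2]
  constructor
  · obtain ⟨z, hz, e⟩ := sum_termNegEight_half_congr_one hr hr0
    rw [Finset.range_eq_Ico, Finset.sum_eq_sum_Ico_succ_bot (by omega)] at e
    simp only [termNegEight_half] at e
    rw [show Finset.Ico (0 + 1) (4 * r + 1) = Finset.Icc 1 (4 * r) by ext; simp] at e
    simp only [mul_zero, Nat.choose_self, pow_zero, Nat.cast_one, mul_one, add_sub_cancel_left]
      at e
    generalize hS : (∑ k ∈ Finset.Icc 1 (4 * r), ((2 * k).choose k : ℤ) * (-2) ^ k) = S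
    have hS' : (S : ℚ) = p ^ 2 * z := by
      rw [← e, ← hS]
      push_cast
      rfl
    have hd : (S * z.den : ℤ) = p ^ 2 * z.num := by
      have : (S : ℚ) * z.den = p ^ 2 * z.num := by
        rw [hS', mul_assoc, Rat.mul_den_eq_num]
      exact_mod_cast this
    rw [Int.modEq_zero_iff_dvd]
    have hc : IsCoprime ((p : ℤ) ^ 2) (z.den : ℤ) :=
      (Nat.isCoprime_iff_coprime.2 (mem_pIntegral.1 hz).symm).pow_left
    exact hc.dvd_of_dvd_mul_right ⟨_, hd⟩
  · obtain ⟨z, hz, e⟩ := sum_termNegEighth_half_congr hr hr0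
    refine ⟨z, (mem_pIntegral.1 hz).pow_right 2, ?_⟩
    rw [Nat.cast_pow, ← e]
    simp only [termNegEighth_half]
    rw [show Finset.Icc 0 (5 * r) = Finset.range (5 * r + 1) by ext; simp]
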